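/- Let $n\ge 0$ and let $\omega_{C,n}=\frac i2\sum_{j=1}^n\frac{dz_j\wedge d\bar z_j}{1+|z_j|^2}=\sum_{j=1}^n\frac{dx_j\wedge dy_j}{1+|z_j|^2}$ be the Kähler form on $\mathbb{C}^n$ of the product $g_{C,n}=\sum_{j=1}^n\frac{dx_j^2+dy_j^2}{1+|z_j|^2}$ of $n$ copies of the Cigar soliton ($z_j=x_j+iy_j$). Let $\omega_0=\sum_{j=1}^n dx_j\wedge dy_j$ be the standard symplectic form on $\mathbb{R}^{2n}\simeq\mathbb{C}^n$. Then the map $$\Psi_{C,n}:\mathbb{C}^n\to\mathbb{C}^n\simeq\mathbb{R}^{2n},\qquad (z_1,\dots,z_n)\mapsto(\psi_1z_1,\dots,\psi_nz_n),\qquad \psi_j=\sqrt{\frac{\log(1+|z_j|^2)}{|z_j|^2}}$$ (with $\psi_jz_j=0$ if $z_j=0$) is a symplectomorphism of $(\mathbb{C}^n,\omega_{C,n})$ onto $(\mathbb{R}^{2n},\omega_0)$, that is, a smooth diffeomorphism with $\Psi_{C,n}^*\omega_0=\omega_{C,n}$, and $\Psi_{C,n}(0)=0$. Moreover, $\Psi_{C,n}$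 takes every complete complex totally geodesic submanifold of $(\mathbb{C}^n,g_{C,n})$ through the origin onto a complex linear subspace of $\mathbb{C}^n$: if $S$ is a connected complex manifold of some dimension $k$ and $f:S\to\mathbb{C}^n$ is a holomorphic totally geodesic immersion such that $f^*g_{C,n}$ is complete and $0\in f(S)$, then $\Psi_{C,n}(f(S))$ is a complex linear subspace of $\mathbb{C}^n$. -/

import Mathlib

open Set Filter Topology MeasureTheory
open scoped Manifold ContDiff ENNReal

noncomputable section

namespace Cigar

/-! ### The product of cigar solitons and the standard symplectic form

`ℂⁿ` is the space `Fin n → ℂ`, identified with `ℝ²ⁿ` through `z_j = x_j + i y_j`. The tangent space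
at each point is `ℂⁿ` itself. -/

/-- The product of `n` cigar metrics: `∑ (dx_j² + dy_j²) / (1 + |z_j|²)` on `ℂⁿ`. -/
def cigarMetric (n : ℕ) (z v w : Fin n → ℂ) : ℝ :=
  ∑ j, ((v j).re * (w j).re + (v j).im * (w j).im) / (1 + ‖z j‖ ^ 2)

/-- Its Kähler form `ω(v, w) = g(iv, w)`, that is
`(i/2) ∑ dz_j ∧ dz̄_j / (1 + |z_j|²) = ∑ dx_j ∧ dy_j / (1 + |z_j|²)`. -/
def cigarForm (n : ℕ) (z v w : Fin n → ℂ) : ℝ :=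
  cigarMetric n z (Complex.I • v) w

/-- The standard symplectic form `∑ dx_j ∧ dy_j` on `ℝ²ⁿ = ℂⁿ` (constant in the point `z`). -/
def standardForm (n : ℕ) (_z v w : Fin n → ℂ) : ℝ :=
  ∑ j, ((v j).re * (w j).im - (v j).im * (w j).re)

theorem cigarForm_eq (n : ℕ) (z v w : Fin n → ℂ) :
    cigarForm n z v w =
      ∑ j, ((v j).re * (w j).im - (v j).im * (w j).re) / (1 + ‖z j‖ ^ 2) := by
  unfold cigarForm cigarMetric
  refine Finset.sum_congr rfl fun j _ => ?_
  simp
  ring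

/-- `Ψ` is a symplectomorphism from `(E, Ω₁)` onto `(F, Ω₂)`: a diffeomorphism of class `C^∞` of
`E` onto `F` with `Ψ^* Ω₂ = Ω₁`. -/
structure IsSymplectomorphism {E F : Type*} [NormedAddCommGroup E] [NormedSpace ℝ E]
    [NormedAddCommGroup F] [NormedSpace ℝ F]
    (Ω₁ : E → E → E → ℝ) (Ω₂ : F → F → F → ℝ) (Ψ : E → F) : Prop where
  contDiff : ContDiff ℝ ∞ Ψ
  exists_inverse : ∃ Φ : F → E, ContDiff ℝ ∞ Φ ∧
    Function.LeftInverse Φ Ψ ∧ Function.RightInverse Φ Ψ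
  pullback : ∀ z v w : E, Ω₂ (Ψ z) (fderiv ℝ Ψ z v) (fderiv ℝ Ψ z w) = Ω₁ z v w

/-! ### Immersed complex submanifolds -/

/-- The Christoffel symbol of the first kind of a Riemannian metric `g` on (an open part of) a vector
space: for constant vector fields `v`, `w`, `u`, it is `g(∇_v w, u)` at `p`, where `∇` is the
Levi-Civita connection of `g` (Koszul formula). -/
def christoffel {E : Type*} [NormedAddCommGroup E] [NormedSpace ℝ E]
    (g : E → E → E → ℝ) (p v w u : E) : ℝ :=
  (1 / 2) * (fderiv ℝ (fun q => g q w u) p v + fderiv ℝ (fun q => g q v u) p w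
    - fderiv ℝ (fun q => g q v w) p u)

section Submanifold

variable {n : ℕ} (k : ℕ) {S : Type*} [TopologicalSpace S] [ChartedSpace (Fin k → ℂ) S]

/-- `f : S → ℂⁿ` is a holomorphic immersion of the `k`-dimensional complex manifold `S`. -/
structure IsHolomorphicImmersion (f : S → Fin n → ℂ) : Prop where
  holomorphic : ContMDiff 𝓘(ℂ, Fin k → ℂ) 𝓘(ℂ, Fin n → ℂ) ω f
  injective_mfderiv : ∀ p : S,
    Function.Injective (mfderiv 𝓘(ℂ, Fin k → ℂ) 𝓘(ℂ, Fin n → ℂ) f p)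

/-- The immersion `f` is totally geodesic for the metric `g` on `ℂⁿ`: its second fundamental form
vanishes. In a chart, with `F` the local expression of `f`, this says that for all coordinate
directions `v`, `w` the ambient covariant derivative of `∂F/∂w` along `∂F/∂v`, namely
`∂²F/∂v∂w + Γ(∂F/∂v, ∂F/∂w)`, is `g`-orthogonal to every vector `u` normal to the image. -/
def IsTotallyGeodesic (g : (Fin n → ℂ) → (Fin n → ℂ) → (Fin n → ℂ) → ℝ) (f : S → Fin n → ℂ) :
    Prop :=
  ∀ e ∈ atlas (Fin k → ℂ) S, ∀ x ∈ e.target,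
    let F : (Fin k → ℂ) → Fin n → ℂ := f ∘ e.symm
    ∀ u : Fin n → ℂ, (∀ a : Fin k → ℂ, g (F x) (fderiv ℝ F x a) u = 0) →
      ∀ v w : Fin k → ℂ,
        g (F x) (fderiv ℝ (fun y => fderiv ℝ F y w) x v) u
          + christoffel g (F x) (fderiv ℝ F x v) (fderiv ℝ F x w) u = 0

/-- The length, in the metric on `S` induced by `g` through `f`, of a curve `γ : [0, 1] → S`. -/
def curveLength (g : (Fin n → ℂ) → (Fin n → ℂ) → (Fin n → ℂ) → ℝ) (f : S → Fin n → ℂ)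
    (γ : ℝ → S) : ℝ≥0∞ :=
  ∫⁻ t in Icc (0 : ℝ) 1, ENNReal.ofReal
    (Real.sqrt (g (f (γ t)) (deriv (f ∘ γ) t) (deriv (f ∘ γ) t)))

/-- The Riemannian distance on `S` of the metric induced by `g` through `f`: the infimum of the
lengths of the `C¹` curves from `p` to `q` in `S`. -/
def inducedDist (g : (Fin n → ℂ) → (Fin n → ℂ) → (Fin n → ℂ) → ℝ) (f : S → Fin n → ℂ)
    (p q : S) : ℝ≥0∞ :=
  ⨅ (γ : ℝ → S) (_ : ContMDiffOn 𝓘(ℝ, ℝ) 𝓘(ℝ, Fin k → ℂ) 1 γ (Icc 0 1))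
    (_ : γ 0 = p) (_ : γ 1 = q), curveLength g f γ

/-- `S` is complete in the metric induced by `g` through `f`: every sequence that is Cauchy for the
induced Riemannian distance converges in `S`. -/
def IsCompleteInduced (g : (Fin n → ℂ) → (Fin n → ℂ) → (Fin n → ℂ) → ℝ) (f : S → Fin n → ℂ) :
    Prop :=
  ∀ p : ℕ → S,
    (∀ ε : ℝ≥0∞, 0 < ε → ∃ N : ℕ, ∀ l ≥ N, ∀ m ≥ N, inducedDist k g f (p l) (p m) < ε) →
    ∃ q : S, Tendsto p atTop (𝓝 q)

end Submanifold

end Cigar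

end

/-!
The map is `z_j ↦ s(|z_j|²) z_j` with `s(t) = √(log (1 + t) / t)`. Its inverse has the same shape with
`√((exp t - 1) / t)`; both factors are real analytic because `dslope` of an analytic function is. The
pullback of `dx ∧ dy` under such a map is `(s² + 2 t s s') dx ∧ dy = (t s²)' dx ∧ dy`, here
`dx ∧ dy / (1 + t)`.

Let `f` be a complete totally geodesic holomorphic immersion through `0`, and `V` its tangent space
there. In a chart, with local expression `F`, the vanishing of the second fundamental form says that
`∂²F/∂v∂w` minus the vector with coordinates `F̄_j / (1 + |F_j|²) ∂F_j/∂v ∂F_j/∂w` is tangent to the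
image (`holomorphicallyGeodesic_chart`). The conjugate `F̄` is the only factor that is not holomorphic,
so it can be treated as an independent variable (`eq_zero_of_conj_eq_zero`, `polarized_geodesic`).
Putting it equal to `0`, the second derivatives of `F` are tangent, hence the tangent space is locally
constant and `F` stays in `V`. Evaluating the other factors at the base point, where `F = 0`, and
differentiating in the conjugate variable, `V` is stable under the componentwise product `a b c̄`
(`local_structure`).

By the identity theorem `f(S) ⊆ V`, and since `f` is a local diffeomorphism into `V`, segments from `0`
lift to `S` as long as the lift converges. Lifts have finite length, so completeness gives
`f(S) = V` (`range_eq_of_complete`). Finally a subspace stable under `a b c̄` is stable under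
`z ↦ (p(|z_j|²) z_j)_j` for polynomials `p`, and by Lagrange interpolation under every radial map
(`radialMap_mem`); applied to the map and its inverse this shows that `V` is mapped onto itself.
-/

noncomputable section

namespace Cigar

/-! ### Radial maps and the symplectomorphism -/

/-- The map of `ℂⁿ` that multiplies the coordinate `z_j` by the real factor `s (|z_j|²)`. -/
def radialMap (n : ℕ) (s : ℝ → ℝ) (z : Fin n → ℂ) : Fin n → ℂ :=
  fun j => ((s (‖z j‖ ^ 2) : ℝ) : ℂ) * z j

theorem analyticAt_dslope {h : ℝ → ℝ} {a t : ℝ} (ha : AnalyticAt ℝ h a) (ht : AnalyticAt ℝ h t) :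
    AnalyticAt ℝ (dslope h a) t := by
  rcases eq_or_ne t a with rfl | hne
  · obtain ⟨p, hp⟩ := ha
    exact ⟨_, hp.has_fpower_series_dslope_fslope⟩
  · have h1 : AnalyticAt ℝ (fun x => (x - a)⁻¹ * (h x - h a)) t := by
      have : t - a ≠ 0 := sub_ne_zero.2 hne
      fun_prop (disch := assumption)
    refine h1.congr ?_
    filter_upwards [isOpen_ne.mem_nhds hne] with x hx
    rw [dslope_of_ne _ hx, slope_def_module, smul_eq_mul]

/-- The factor `√(log (1 + t) / t)`, with its limit `1` at `t = 0`. -/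
def logScale (t : ℝ) : ℝ := Real.sqrt (dslope (fun x => Real.log (1 + x)) 0 t)

/-- The factor `√((exp t - 1) / t)`, with its limit `1` at `t = 0`. -/
def expScale (t : ℝ) : ℝ := Real.sqrt (dslope Real.exp 0 t)

theorem analyticAt_log_one_add {t : ℝ} (ht : -1 < t) :
    AnalyticAt ℝ (fun x => Real.log (1 + x)) t := by
  have : 0 < 1 + t := by linarith
  fun_prop (disch := assumption)

theorem dslope_log_pos {t : ℝ} (ht : -1 < t) :
    0 < dslope (fun x => Real.log (1 + x)) 0 t := by
  rcases lt_trichotomy t 0 with h | h | h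
  · rw [dslope_of_ne _ h.ne, slope_def_field]
    simp only [add_zero, Real.log_one, sub_zero]
    exact div_pos_of_neg_of_neg (Real.log_neg (by linarith) (by linarith)) h
  · subst h
    have : HasDerivAt (fun x : ℝ => Real.log (1 + x)) 1 0 := by
      simpa using ((hasDerivAt_id (0 : ℝ)).const_add 1).log (by simp)
    rw [dslope_same, this.deriv]
    exact one_pos
  · rw [dslope_of_ne _ h.ne', slope_def_field]
    simp only [add_zero, Real.log_one, sub_zero]
    exact div_pos (Real.log_pos (by linarith)) h

theorem dslope_exp_pos (t : ℝ) : 0 < dslope Real.exp 0 t := by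
  rcases lt_trichotomy t 0 with h | h | h
  · rw [dslope_of_ne _ h.ne, slope_def_field]
    have := Real.exp_lt_one_iff.2 h
    simp only [Real.exp_zero, sub_zero]
    exact div_pos_of_neg_of_neg (by linarith) h
  · subst h
    simp
  · rw [dslope_of_ne _ h.ne', slope_def_field]
    have := Real.one_lt_exp_iff.2 h
    simp only [Real.exp_zero, sub_zero]
    exact div_pos (by linarith) h

theorem contDiffAt_logScale {t : ℝ} (ht : -1 < t) : ContDiffAt ℝ ∞ logScale t :=
  ((analyticAt_dslope (analyticAt_log_one_add (by norm_num))
    (analyticAt_log_one_add ht)).contDiffAt).sqrt (dslope_log_pos ht).ne'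

theorem contDiffAt_expScale (t : ℝ) : ContDiffAt ℝ ∞ expScale t :=
  ((analyticAt_dslope analyticAt_rexp analyticAt_rexp).contDiffAt).sqrt
    (dslope_exp_pos t).ne'

theorem mul_logScale_sq {t : ℝ} (ht : -1 < t) : t * logScale t ^ 2 = Real.log (1 + t) := by
  rw [logScale, Real.sq_sqrt (dslope_log_pos ht).le]
  simpa using sub_smul_dslope (fun x => Real.log (1 + x)) 0 t

theorem mul_expScale_sq (t : ℝ) : t * expScale t ^ 2 = Real.exp t - 1 := by
  rw [expScale, Real.sq_sqrt (dslope_exp_pos t).le]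
  simpa using sub_smul_dslope Real.exp 0 t

theorem logScale_pos {t : ℝ} (ht : -1 < t) : 0 < logScale t := Real.sqrt_pos.2 (dslope_log_pos ht)

theorem expScale_pos (t : ℝ) : 0 < expScale t := Real.sqrt_pos.2 (dslope_exp_pos t)

/-- At `t = 0` the left side is `√(0 / 0) = 0`, which is why the factor is compared only after
multiplication by `z`. -/
theorem sqrt_log_div_mul (z : ℂ) :
    ((Real.sqrt (Real.log (1 + ‖z‖ ^ 2) / ‖z‖ ^ 2) : ℝ) : ℂ) * z =
      ((logScale (‖z‖ ^ 2) : ℝ) : ℂ) * z := by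
  rcases eq_or_ne z 0 with rfl | hz
  · simp
  · have h : ‖z‖ ^ 2 ≠ 0 := by simpa using hz
    rw [logScale, dslope_of_ne _ h, slope_def_field]
    simp

theorem contDiff_radialMap {n : ℕ} {s : ℝ → ℝ} (hs : ∀ t, 0 ≤ t → ContDiffAt ℝ ∞ s t) :
    ContDiff ℝ ∞ (radialMap n s) := by
  refine contDiff_pi.2 fun j => contDiff_iff_contDiffAt.2 fun z => ?_
  have h1 : ContDiffAt ℝ ∞ (fun z : Fin n → ℂ => z j) z := contDiffAt_apply ℝ ℂ j z
  have h2 : ContDiffAt ℝ ∞ (fun z : Fin n → ℂ => s (‖z j‖ ^ 2)) z :=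
    ContDiffAt.comp z (hs _ (by positivity)) (h1.norm_sq ℝ)
  exact (Complex.ofRealCLM.contDiff.contDiffAt.comp z h2).mul h1

theorem radialMap_comp {n : ℕ} {s r : ℝ → ℝ}
    (h : ∀ t, 0 ≤ t → 0 ≤ s t ∧ r (t * s t ^ 2) * s t = 1) (z : Fin n → ℂ) :
    radialMap n r (radialMap n s z) = z := by
  funext j
  have h1 : ‖radialMap n s z j‖ ^ 2 = ‖z j‖ ^ 2 * s (‖z j‖ ^ 2) ^ 2 := by
    rw [radialMap, norm_mul, Complex.norm_real, mul_pow, Real.norm_eq_abs, sq_abs]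
    ring
  have h2 := (h (‖z j‖ ^ 2) (by positivity)).2
  rw [radialMap, h1, radialMap, ← mul_assoc, ← Complex.ofReal_mul, h2]
  simp

theorem expScale_mul_logScale {t : ℝ} (ht : -1 < t) :
    expScale (t * logScale t ^ 2) * logScale t = 1 := by
  have h1 := mul_expScale_sq (t * logScale t ^ 2)
  have hp : 0 < expScale (t * logScale t ^ 2) * logScale t :=
    mul_pos (expScale_pos _) (logScale_pos ht)
  rw [mul_logScale_sq ht, Real.exp_log (by linarith), ← mul_logScale_sq ht] at h1
  rcases eq_or_ne t 0 with rfl | h0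
  · simp [expScale, logScale]
    have : HasDerivAt (fun x : ℝ => Real.log (1 + x)) 1 0 := by
      simpa using ((hasDerivAt_id (0 : ℝ)).const_add 1).log (by simp)
    rw [this.deriv]
  · have h2 : (expScale (t * logScale t ^ 2) * logScale t) ^ 2 = 1 := by
      apply mul_left_cancel₀ h0
      linear_combination h1
    nlinarith

theorem logScale_mul_expScale (t : ℝ) : logScale (t * expScale t ^ 2) * expScale t = 1 := by
  have hu : -1 < t * expScale t ^ 2 := by
    rw [mul_expScale_sq]; linarith [Real.exp_pos t]
  have h1 := mul_logScale_sq hu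
  have hp : 0 < logScale (t * expScale t ^ 2) * expScale t :=
    mul_pos (logScale_pos hu) (expScale_pos _)
  have h2 := expScale_mul_logScale hu
  rw [h1, mul_expScale_sq, add_sub_cancel, Real.log_exp, mul_comm, ← mul_expScale_sq] at h2
  exact h2

theorem leftInverse_expScale_logScale (n : ℕ) :
    Function.LeftInverse (radialMap n expScale) (radialMap n logScale) :=
  radialMap_comp fun t ht =>
    ⟨(logScale_pos (by linarith)).le, expScale_mul_logScale (by linarith)⟩

theorem leftInverse_logScale_expScale (n : ℕ) :
    Function.LeftInverse (radialMap n logScale) (radialMap n expScale) :=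
  radialMap_comp fun t _ => ⟨(expScale_pos t).le, logScale_mul_expScale t⟩

theorem fderiv_radialMap_apply {n : ℕ} {s : ℝ → ℝ} (z v : Fin n → ℂ) (j : Fin n)
    (hs : ∀ t, 0 ≤ t → ContDiffAt ℝ ∞ s t) :
    fderiv ℝ (radialMap n s) z v j = ((s (‖z j‖ ^ 2) : ℝ) : ℂ) * v j +
      ((deriv s (‖z j‖ ^ 2) * (2 * ((z j).re * (v j).re + (z j).im * (v j).im)) : ℝ) : ℂ) * z j := by
  have hd : DifferentiableAt ℝ (radialMap n s) z :=
    (contDiff_radialMap hs).differentiable (by simp) z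
  -- the derivative in the direction `v` is computed along the line `x ↦ z + x v`
  have hl : HasDerivAt (fun x : ℝ => z + x • v) v 0 := by
    simpa using ((hasDerivAt_id (0 : ℝ)).smul_const v).const_add z
  have hlj : HasDerivAt (fun x : ℝ => z j + x • v j) (v j) 0 := by
    simpa using ((hasDerivAt_id (0 : ℝ)).smul_const (v j)).const_add (z j)
  have h1 : HasDerivAt (fun x : ℝ => radialMap n s (z + x • v) j)
      (fderiv ℝ (radialMap n s) z v j) 0 := by
    have hd' : HasFDerivAt (radialMap n s) (fderiv ℝ (radialMap n s) z) (z + (0 : ℝ) • v) := by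
      simpa using hd.hasFDerivAt
    exact hasDerivAt_pi.1 (hd'.comp_hasDerivAt (0 : ℝ) hl) j
  have hsq : HasDerivAt (fun x : ℝ => ‖z j + x • v j‖ ^ 2)
      (2 * ((z j).re * (v j).re + (z j).im * (v j).im)) 0 := by
    have := hlj.norm_sq
    simpa [Complex.inner, mul_comm] using this
  have h2 : HasDerivAt s (deriv s (‖z j‖ ^ 2)) (‖z j + (0 : ℝ) • v j‖ ^ 2) := by
    simpa using ((hs (‖z j‖ ^ 2) (by positivity)).differentiableAt (by simp)).hasDerivAt
  have h3 := (h2.comp (0 : ℝ) hsq).ofReal_comp.mul hlj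
  have h4 := h1.unique h3
  rw [h4]
  simp
  ring

theorem pullback_radialMap (n : ℕ) (z v w : Fin n → ℂ) :
    standardForm n (radialMap n logScale z) (fderiv ℝ (radialMap n logScale) z v)
      (fderiv ℝ (radialMap n logScale) z w) = cigarForm n z v w := by
  have hs : ∀ t, 0 ≤ t → ContDiffAt ℝ ∞ logScale t := fun t ht =>
    contDiffAt_logScale (by linarith)
  rw [cigarForm_eq, standardForm]
  refine Finset.sum_congr rfl fun j _ => ?_
  rw [fderiv_radialMap_apply z v j hs, fderiv_radialMap_apply z w j hs]
  have hn : ‖z j‖ ^ 2 = (z j).re ^ 2 + (z j).im ^ 2 := by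
    rw [← Complex.normSq_eq_norm_sq, Complex.normSq_apply]; ring
  -- differentiating `t s(t)² = log (1 + t)` gives `s² + 2 t s s' = 1 / (1 + t)`
  have key : logScale (‖z j‖ ^ 2) ^ 2
      + 2 * ‖z j‖ ^ 2 * logScale (‖z j‖ ^ 2) * deriv logScale (‖z j‖ ^ 2)
        = 1 / (1 + ‖z j‖ ^ 2) := by
    set t := ‖z j‖ ^ 2
    have ht : 0 ≤ t := by positivity
    have hd : HasDerivAt logScale (deriv logScale t) t :=
      ((hs t ht).differentiableAt (by simp)).hasDerivAt
    have h1 : HasDerivAt (fun t => t * logScale t ^ 2) _ t := (hasDerivAt_id t).mul (hd.pow 2)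
    have h2 : HasDerivAt (fun t : ℝ => Real.log (1 + t)) (1 / (1 + t)) t :=
      ((hasDerivAt_id t).const_add 1).log (by simp; linarith)
    have h3 : (fun t => t * logScale t ^ 2) =ᶠ[𝓝 t] fun t : ℝ => Real.log (1 + t) := by
      filter_upwards [lt_mem_nhds (show (-1 : ℝ) < t by linarith)] with x hx
      exact mul_logScale_sq hx
    have h4 := h1.unique (h2.congr_of_eventuallyEq h3)
    simp at h4
    rw [one_div, ← h4]
    ring
  rw [div_eq_mul_one_div, ← key]
  simp [hn]
  ring

theorem isSymplectomorphism_radialMap (n : ℕ) :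
    IsSymplectomorphism (cigarForm n) (standardForm n) (radialMap n logScale) where
  contDiff := contDiff_radialMap fun t ht => contDiffAt_logScale (by linarith)
  exists_inverse := ⟨radialMap n expScale, contDiff_radialMap fun t _ => contDiffAt_expScale t,
    leftInverse_expScale_logScale n, leftInverse_logScale_expScale n⟩
  pullback := pullback_radialMap n

/-! ### Subspaces stable under the componentwise triple product -/

/-- If `V` is stable under the componentwise product `a b c̄`, it is stable under radial maps: on the
finitely many values `|z_j|²` the factor agrees with a polynomial, and `|z_j|² z_j = z_j z_j z̄_j`. -/
theorem radialMap_mem {n : ℕ} {V : Submodule ℂ (Fin n → ℂ)}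
    (hV : ∀ a ∈ V, ∀ b ∈ V, ∀ c ∈ V, (fun j => a j * b j * starRingEnd ℂ (c j)) ∈ V)
    (s : ℝ → ℝ) {z : Fin n → ℂ} (hz : z ∈ V) : radialMap n s z ∈ V := by
  have hpow : ∀ m : ℕ, (fun j => ((‖z j‖ ^ 2 : ℝ) : ℂ) ^ m * z j) ∈ V := by
    intro m
    induction m with
    | zero => simpa using hz
    | succ m ih =>
      convert! hV _ ih z hz z hz using 1
      funext j
      have := Complex.mul_conj' (z j)
      push_cast
      rw [mul_assoc, this]
      ring
  have hpoly : ∀ p : Polynomial ℝ,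
      (fun j => ((p.eval (‖z j‖ ^ 2) : ℝ) : ℂ) * z j) ∈ V := by
    intro p
    induction p using Polynomial.induction_on' with
    | add p q hp hq =>
      convert! V.add_mem hp hq using 1
      funext j
      simp [add_mul]
    | monomial m c =>
      convert! V.smul_mem (c : ℂ) (hpow m) using 1
      funext j
      simp [mul_assoc]
  let T : Finset ℝ := Finset.univ.image fun j => ‖z j‖ ^ 2
  convert! hpoly (Lagrange.interpolate T id s) using 1
  funext j
  have : ‖z j‖ ^ 2 ∈ T := Finset.mem_image_of_mem _ (Finset.mem_univ j)
  have h := Lagrange.eval_interpolate_at_node s (Set.injOn_id (T : Set ℝ)) this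
  simp only [id] at h
  rw [radialMap, ← h]

theorem image_radialMap_eq {n : ℕ} {V : Submodule ℂ (Fin n → ℂ)}
    (hV : ∀ a ∈ V, ∀ b ∈ V, ∀ c ∈ V, (fun j => a j * b j * starRingEnd ℂ (c j)) ∈ V) :
    radialMap n logScale '' (V : Set (Fin n → ℂ)) = V := by
  refine Subset.antisymm (image_subset_iff.2 fun z hz => radialMap_mem hV _ hz) fun w hw => ?_
  exact ⟨radialMap n expScale w, radialMap_mem hV _ hw, leftInverse_logScale_expScale n w⟩

/-! ### Polarization -/

/-- A function of one complex variable, differentiable on a disc about `0` and zero at the real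
points of the disc, is zero. -/
theorem eq_zero_of_real_eq_zero {h : ℂ → ℂ} {r : ℝ}
    (hd : DifferentiableOn ℂ h (Metric.ball 0 r))
    (h0 : ∀ x : ℝ, |x| < r → h x = 0) {z : ℂ} (hz : ‖z‖ < r) : h z = 0 := by
  have hr : 0 < r := (norm_nonneg z).trans_lt hz
  have ha : AnalyticOnNhd ℂ h (Metric.ball 0 r) := hd.analyticOnNhd Metric.isOpen_ball
  refine ha.eqOn_zero_of_preconnected_of_frequently_eq_zero
    (convex_ball (0 : ℂ) r).isPreconnected (Metric.mem_ball_self hr) ?_ (by simpa using hz)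
  have ht : Tendsto (fun x : ℝ => (x : ℂ)) (𝓝[≠] 0) (𝓝[≠] (0 : ℂ)) := by
    refine tendsto_nhdsWithin_iff.2 ⟨?_, ?_⟩
    · exact (Complex.continuous_ofReal.tendsto' 0 0 (by simp)).mono_left nhdsWithin_le_nhds
    · filter_upwards [self_mem_nhdsWithin] with x hx
      simpa using hx
  refine ht.frequently (Eventually.frequently ?_)
  filter_upwards [nhdsWithin_le_nhds (Metric.ball_mem_nhds (0 : ℝ) hr)] with x hx
  exact h0 x (by simpa using hx)

/-- Polarization: a holomorphic function of two variables that vanishes on the totally real plane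
`{(τ, τ̄)}` vanishes. In the coordinates `τ = s + i t`, `σ = s - i t` it vanishes for real `s`, `t`,
hence for complex ones. -/
theorem eq_zero_of_conj_eq_zero {H : ℂ × ℂ → ℂ} {r : ℝ}
    (hd : DifferentiableOn ℂ H (Metric.ball 0 r ×ˢ Metric.ball 0 r))
    (h0 : ∀ τ : ℂ, ‖τ‖ < r → H (τ, starRingEnd ℂ τ) = 0) {τ σ : ℂ}
    (h1 : ‖τ + σ‖ < r) (h2 : ‖τ - σ‖ < r) : H (τ, σ) = 0 := by
  have hmem : ∀ s t : ℂ, ‖s‖ < r / 2 → ‖t‖ < r / 2 →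
      (s + Complex.I * t, s - Complex.I * t) ∈ Metric.ball (0 : ℂ) r ×ˢ Metric.ball (0 : ℂ) r := by
    intro s t hs ht
    have hI : ‖Complex.I * t‖ = ‖t‖ := by simp
    refine ⟨?_, ?_⟩
    · rw [mem_ball_zero_iff]
      exact (norm_add_le _ _).trans_lt (by rw [hI]; linarith)
    · rw [mem_ball_zero_iff]
      exact (norm_sub_le _ _).trans_lt (by rw [hI]; linarith)
  have hdst : ∀ s t : ℂ, ‖s‖ < r / 2 → ‖t‖ < r / 2 →
      DifferentiableAt ℂ H (s + Complex.I * t, s - Complex.I * t) := fun s t hs ht =>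
    hd.differentiableAt ((Metric.isOpen_ball.prod Metric.isOpen_ball).mem_nhds (hmem s t hs ht))
  have hreal : ∀ s t : ℝ, |s| < r / 2 → |t| < r / 2 →
      H ((s : ℂ) + Complex.I * t, (s : ℂ) - Complex.I * t) = 0 := by
    intro s t hs ht
    have h := h0 ((s : ℂ) + Complex.I * t)
      (by simpa using (hmem s t (by simpa using hs) (by simpa using ht)).1)
    simpa [sub_eq_add_neg] using h
  have hreal1 : ∀ s : ℝ, |s| < r / 2 → ∀ t : ℂ, ‖t‖ < r / 2 →
      H ((s : ℂ) + Complex.I * t, (s : ℂ) - Complex.I * t) = 0 := by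
    intro s hs t ht
    refine eq_zero_of_real_eq_zero (h := fun t => H ((s : ℂ) + Complex.I * t, (s : ℂ) - Complex.I * t))
      (fun t ht => ?_) (fun t ht => hreal s t hs ht) ht
    refine DifferentiableAt.differentiableWithinAt ?_
    exact DifferentiableAt.comp (g := H) (f := fun t : ℂ => ((s : ℂ) + Complex.I * t, (s : ℂ) - Complex.I * t)) t
      (hdst s t (by simpa using hs) (by simpa using ht)) (by fun_prop)
  have hcomplex : ∀ t : ℂ, ‖t‖ < r / 2 → ∀ s : ℂ, ‖s‖ < r / 2 →
      H (s + Complex.I * t, s - Complex.I * t) = 0 := by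
    intro t ht s hs
    refine eq_zero_of_real_eq_zero (h := fun s => H (s + Complex.I * t, s - Complex.I * t))
      (fun s hs => ?_) (fun s hs => hreal1 s hs t ht) hs
    refine DifferentiableAt.differentiableWithinAt ?_
    exact DifferentiableAt.comp (g := H) (f := fun s : ℂ => (s + Complex.I * t, s - Complex.I * t)) s
      (hdst s t (by simpa using hs) ht) (by fun_prop)
  have h := hcomplex (-Complex.I * (τ - σ) / 2) (by simp; linarith) ((τ + σ) / 2) (by simp; linarith)
  have e1 : Complex.I * (-Complex.I * (τ - σ) / 2) = (τ - σ) / 2 := by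
    linear_combination (-(τ - σ) / 2) * Complex.I_mul_I
  rw [e1] at h
  convert! h using 3 <;> ring

/-! ### Local structure of a totally geodesic immersion -/

section Local

variable {n : ℕ} {E : Type*} [NormedAddCommGroup E] [NormedSpace ℂ E]

/-- The projection of `ℂⁿ` along `D(E)` onto the kernel of `A`, when `A ∘ D` is invertible (otherwise
`Ring.inverse` is `0` and this is the identity). It depends holomorphically on `D`. -/
def normalProj (A : (Fin n → ℂ) →L[ℂ] E) (D : E →L[ℂ] (Fin n → ℂ)) :
    (Fin n → ℂ) →L[ℂ] (Fin n → ℂ) :=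
  ContinuousLinearMap.id ℂ _ - D.comp ((Ring.inverse (A.comp D)).comp A)

theorem normalProj_apply_range {A : (Fin n → ℂ) →L[ℂ] E} {D : E →L[ℂ] (Fin n → ℂ)}
    (h : IsUnit (A.comp D)) (a : E) : normalProj A D (D a) = 0 := by
  have h1 : Ring.inverse (A.comp D) * A.comp D = 1 := Ring.inverse_mul_cancel _ h
  have h2 : Ring.inverse (A.comp D) (A (D a)) = a := DFunLike.congr_fun h1 a
  simp [normalProj, h2]

theorem differentiableAt_normalProj [CompleteSpace E] {A : (Fin n → ℂ) →L[ℂ] E}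
    {D : E →L[ℂ] (Fin n → ℂ)} (h : IsUnit (A.comp D)) :
    DifferentiableAt ℂ (normalProj A) D := by
  have h1 : DifferentiableAt ℂ (fun D : E →L[ℂ] (Fin n → ℂ) => A.comp D) D := by fun_prop
  have h2 : DifferentiableAt ℂ (Ring.inverse : (E →L[ℂ] E) → _) (A.comp D) := by
    obtain ⟨u, hu⟩ := h
    rw [← hu]
    exact (contDiffAt_ringInverse ℂ u (n := 1)).differentiableAt (by simp)
  have h3 : DifferentiableAt ℂ (fun D : E →L[ℂ] (Fin n → ℂ) => Ring.inverse (A.comp D)) D :=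
    h2.comp D h1
  exact (differentiableAt_const _).sub
    (differentiableAt_id.clm_comp (h3.clm_comp (differentiableAt_const A)))

/-- The vector with coordinates `w̄_j a_j b_j / (1 + z_j w̄_j)`, where the conjugate of `w` is the
argument `w'`. For `w' = z̄` this is minus the Christoffel term of the product of cigars; separating
`w'` from `z̄` makes it holomorphic in both. -/
def connectionTerm (z w' a b : Fin n → ℂ) : Fin n → ℂ :=
  fun j => w' j / (1 + z j * w' j) * (a j * b j)

theorem connectionTerm_zero_left (w' a b : Fin n → ℂ) :
    connectionTerm 0 w' a b = fun j => w' j * (a j * b j) := by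
  funext j; simp [connectionTerm]

theorem connectionTerm_zero_right (z a b : Fin n → ℂ) : connectionTerm z 0 a b = 0 := by
  funext j; simp [connectionTerm]

/-- The holomorphic form of "the second fundamental form of `F` vanishes on `U`": every linear
functional that kills the tangent space kills `∂²F/∂v∂w` minus the connection term. -/
def HolomorphicallyGeodesic (F : E → Fin n → ℂ) (U : Set E) : Prop :=
  ∀ x ∈ U, ∀ l : (Fin n → ℂ) →L[ℂ] ℂ, (∀ a, l (fderiv ℂ F x a) = 0) → ∀ v w,
    l (fderiv ℂ (fderiv ℂ F) x v w) =
      l (connectionTerm (F x) (star (F x)) (fderiv ℂ F x v) (fderiv ℂ F x w))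

variable [CompleteSpace E]

/-- The polarized geodesic equation on the line `x₀ + τ ξ`: the points at which the holomorphic and the
antiholomorphic factors are evaluated may be chosen independently. -/
theorem polarized_geodesic {F : E → Fin n → ℂ} {U : Set E}
    (hF : AnalyticOnNhd ℂ F U) (hG : HolomorphicallyGeodesic F U)
    {A : (Fin n → ℂ) →L[ℂ] E} {x₀ : E} {r : ℝ} (hball : Metric.ball x₀ r ⊆ U)
    (hunit : ∀ x ∈ Metric.ball x₀ r, IsUnit (A.comp (fderiv ℂ F x)))
    (hone : ∀ x ∈ Metric.ball x₀ r, ∀ j, ‖F x j‖ < 1)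
    {ξ : E} (hξ : ‖ξ‖ < r / 2) (v w : E) {τ σ : ℂ} (h1 : ‖τ + σ‖ < 2) (h2 : ‖τ - σ‖ < 2) :
    normalProj A (fderiv ℂ F (x₀ + τ • ξ)) (fderiv ℂ (fderiv ℂ F) (x₀ + τ • ξ) v w) =
      normalProj A (fderiv ℂ F (x₀ + τ • ξ))
        (connectionTerm (F (x₀ + τ • ξ)) (star (F (x₀ + star σ • ξ)))
          (fderiv ℂ F (x₀ + τ • ξ) v) (fderiv ℂ F (x₀ + τ • ξ) w)) := by
  have hmem : ∀ τ : ℂ, ‖τ‖ < 2 → x₀ + τ • ξ ∈ Metric.ball x₀ r := by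
    intro τ hτ
    rw [mem_ball_iff_norm, add_sub_cancel_left, norm_smul]
    nlinarith [norm_nonneg ξ, norm_nonneg τ]
  have hline : ∀ τ : ℂ, DifferentiableAt ℂ (fun τ : ℂ => x₀ + τ • ξ) τ := fun τ => by fun_prop
  funext i
  rw [← sub_eq_zero, ← Pi.sub_apply, ← map_sub]
  refine eq_zero_of_conj_eq_zero (r := 2) (H := fun p : ℂ × ℂ =>
    normalProj A (fderiv ℂ F (x₀ + p.1 • ξ))
      (fderiv ℂ (fderiv ℂ F) (x₀ + p.1 • ξ) v w -
        connectionTerm (F (x₀ + p.1 • ξ)) (star (F (x₀ + star p.2 • ξ)))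
          (fderiv ℂ F (x₀ + p.1 • ξ) v) (fderiv ℂ F (x₀ + p.1 • ξ) w)) i)
    (τ := τ) (σ := σ) ?_ ?_ h1 h2
  · rintro ⟨τ, σ⟩ ⟨hτ, hσ⟩
    rw [mem_ball_zero_iff] at hτ hσ
    refine DifferentiableAt.differentiableWithinAt ?_
    have hx := hmem τ hτ
    have hx' : x₀ + star σ • ξ ∈ Metric.ball x₀ r := hmem _ (by simpa using hσ)
    have hL : DifferentiableAt ℂ (fun p : ℂ × ℂ => x₀ + p.1 • ξ) (τ, σ) := by fun_prop
    have dF : DifferentiableAt ℂ (fun p : ℂ × ℂ => F (x₀ + p.1 • ξ)) (τ, σ) :=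
      DifferentiableAt.comp (g := F) (τ, σ) (hF _ (hball hx)).differentiableAt hL
    have dD : DifferentiableAt ℂ (fun p : ℂ × ℂ => fderiv ℂ F (x₀ + p.1 • ξ)) (τ, σ) :=
      DifferentiableAt.comp (g := fderiv ℂ F) (τ, σ) (hF.fderiv _ (hball hx)).differentiableAt hL
    have dD2 : DifferentiableAt ℂ (fun p : ℂ × ℂ => fderiv ℂ (fderiv ℂ F) (x₀ + p.1 • ξ)) (τ, σ) :=
      DifferentiableAt.comp (g := fderiv ℂ (fderiv ℂ F)) (τ, σ)
        (hF.fderiv.fderiv _ (hball hx)).differentiableAt hL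
    have dP : DifferentiableAt ℂ (fun p : ℂ × ℂ => normalProj A (fderiv ℂ F (x₀ + p.1 • ξ))) (τ, σ) :=
      DifferentiableAt.comp (g := normalProj A) (τ, σ) (differentiableAt_normalProj (hunit _ hx)) dD
    have dG1 : DifferentiableAt ℂ (fun σ : ℂ => star (F (x₀ + star σ • ξ))) σ := by
      have : DifferentiableAt ℂ (fun σ : ℂ => F (x₀ + σ • ξ)) (star σ) :=
        DifferentiableAt.comp (g := F) (star σ) (hF _ (hball hx')).differentiableAt (hline _)
      simpa [Function.comp_def] using this.star_star
    have dG : DifferentiableAt ℂ (fun p : ℂ × ℂ => star (F (x₀ + star p.2 • ξ))) (τ, σ) :=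
      DifferentiableAt.comp (g := fun σ : ℂ => star (F (x₀ + star σ • ξ))) (τ, σ) dG1
        differentiableAt_snd
    have dC : DifferentiableAt ℂ (fun p : ℂ × ℂ =>
        connectionTerm (F (x₀ + p.1 • ξ)) (star (F (x₀ + star p.2 • ξ)))
          (fderiv ℂ F (x₀ + p.1 • ξ) v) (fderiv ℂ F (x₀ + p.1 • ξ) w)) (τ, σ) := by
      refine differentiableAt_pi.2 fun j => ?_
      have g1 := differentiableAt_pi.1 dG j
      have g2 := differentiableAt_pi.1 dF j
      have g3 := differentiableAt_pi.1 (dD.clm_apply (differentiableAt_const v)) j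
      have g4 := differentiableAt_pi.1 (dD.clm_apply (differentiableAt_const w)) j
      have hne : 1 + F (x₀ + τ • ξ) j * star (F (x₀ + star σ • ξ)) j ≠ 0 := by
        intro h
        have h3 : ‖F (x₀ + τ • ξ) j * star (F (x₀ + star σ • ξ)) j‖ = 1 := by
          rw [eq_neg_of_add_eq_zero_right h, norm_neg, norm_one]
        rw [norm_mul, Pi.star_apply, norm_star] at h3
        have h4 := hone _ hx j
        have h5 := hone _ hx' j
        nlinarith [norm_nonneg (F (x₀ + τ • ξ) j), norm_nonneg (F (x₀ + star σ • ξ) j)]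
      have g5 := (differentiableAt_const (1 : ℂ)).fun_add (g2.fun_mul g1)
      simp only [connectionTerm, div_eq_mul_inv]
      exact (g1.fun_mul (g5.fun_inv hne)).fun_mul (g3.fun_mul g4)
    exact differentiableAt_pi.1 (dP.clm_apply
      (((dD2.clm_apply (differentiableAt_const v)).clm_apply (differentiableAt_const w)).sub dC)) i
  · intro τ hτ
    have hx := hmem τ hτ
    have h := hG _ (hball hx) ((ContinuousLinearMap.proj i).comp
      (normalProj A (fderiv ℂ F (x₀ + τ • ξ))))
      (fun a => by simp [normalProj_apply_range (hunit _ hx)]) v w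
    simp only [ContinuousLinearMap.comp_apply, ContinuousLinearMap.proj_apply] at h
    simp [map_sub, h]

/-- A holomorphic immersion that is geodesic for the product of cigars and passes through `0` lies, near
that point, in its tangent space there, and this tangent space is stable under the componentwise
product `a b c̄`. The first claim is the polarized equation at `σ = 0`, where the connection term drops
out: the tangent spaces are then locally constant. The second is the equation at `τ = 0`. -/
theorem local_structure {F : E → Fin n → ℂ} {U : Set E} (hU : IsOpen U)
    (hF : AnalyticOnNhd ℂ F U) (hG : HolomorphicallyGeodesic F U)
    {A : (Fin n → ℂ) →L[ℂ] E} {x₀ : E} (hx₀ : x₀ ∈ U) (h0 : F x₀ = 0)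
    (hA : A.comp (fderiv ℂ F x₀) = ContinuousLinearMap.id ℂ E) :
    (∀ᶠ x in 𝓝 x₀, F x = fderiv ℂ F x₀ (A (F x))) ∧
    ∀ a b c : E, ∃ d : E, fderiv ℂ F x₀ d = fun j =>
      fderiv ℂ F x₀ a j * fderiv ℂ F x₀ b j * starRingEnd ℂ (fderiv ℂ F x₀ c j) := by
  have hcF : ContinuousAt F x₀ := (hF _ hx₀).continuousAt
  have hcD : ContinuousAt (fderiv ℂ F) x₀ := (hF.fderiv _ hx₀).continuousAt
  have e1 : ∀ᶠ x in 𝓝 x₀, IsUnit (A.comp (fderiv ℂ F x)) := by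
    have hc : ContinuousAt (fun x => A.comp (fderiv ℂ F x)) x₀ := by fun_prop
    refine hc.eventually (Units.isOpen.eventually_mem ?_)
    show IsUnit (A.comp (fderiv ℂ F x₀))
    rw [hA]
    exact isUnit_one
  have e2 : ∀ᶠ x in 𝓝 x₀, ∀ j, ‖F x j‖ < 1 := by
    refine eventually_all.2 fun j => ?_
    have : ContinuousAt (fun x => ‖F x j‖) x₀ := (continuousAt_pi.1 hcF j).norm
    exact this.eventually_lt_const (by simp [h0])
  obtain ⟨r, hr, hball⟩ := Metric.eventually_nhds_iff_ball.1 ((hU.eventually_mem hx₀).and (e1.and e2))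
  have hxU : Metric.ball x₀ r ⊆ U := fun x hx => (hball x hx).1
  have hpol := fun {ξ : E} (hξ : ‖ξ‖ < r / 2) (v w : E) {τ σ : ℂ} =>
    polarized_geodesic hF hG hxU (fun x hx => (hball x hx).2.1) (fun x hx => (hball x hx).2.2)
      hξ v w (τ := τ) (σ := σ)
  have hinv : Ring.inverse (A.comp (fderiv ℂ F x₀)) = 1 := by
    rw [hA]; exact Ring.inverse_one _
  -- `σ = 0`: the second derivatives are tangent
  have htan : ∀ x ∈ Metric.ball x₀ (r / 2), ∀ v w,
      normalProj A (fderiv ℂ F x) (fderiv ℂ (fderiv ℂ F) x v w) = 0 := by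
    intro x hx v w
    have h := hpol (ξ := x - x₀) (mem_ball_iff_norm.1 hx) v w (τ := 1) (σ := 0)
      (by simp) (by simp)
    simpa [h0, connectionTerm_zero_right] using h
  have hsub : Metric.ball x₀ (r / 2) ⊆ Metric.ball x₀ r := Metric.ball_subset_ball (by linarith)
  constructor
  · -- `M x = D x (A D x)⁻¹` has derivative zero, since `M (A D) = D`
    let D := fderiv ℂ F
    let M : E → E →L[ℂ] (Fin n → ℂ) := fun x => (D x).comp (Ring.inverse (A.comp (D x)))
    have hMd : ∀ x ∈ Metric.ball x₀ (r / 2), DifferentiableAt ℂ M x := by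
      intro x hx
      have dD : DifferentiableAt ℂ D x := (hF.fderiv _ (hxU (hsub hx))).differentiableAt
      obtain ⟨u, hu⟩ := (hball x (hsub hx)).2.1
      have h2 : DifferentiableAt ℂ (Ring.inverse : (E →L[ℂ] E) → _) (A.comp (D x)) := by
        rw [← hu]
        exact (contDiffAt_ringInverse ℂ u (n := 1)).differentiableAt (by simp)
      exact dD.clm_comp (DifferentiableAt.comp (g := Ring.inverse) x h2
        ((differentiableAt_const A).clm_comp dD))
    have hMD : ∀ x ∈ Metric.ball x₀ (r / 2), (M x).comp (A.comp (D x)) = D x := by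
      intro x hx
      have h1 : Ring.inverse (A.comp (D x)) * A.comp (D x) = 1 :=
        Ring.inverse_mul_cancel _ (hball x (hsub hx)).2.1
      show (D x).comp (Ring.inverse (A.comp (D x)) * A.comp (D x)) = D x
      rw [h1]
      rfl
    have hM0 : ∀ x ∈ Metric.ball x₀ (r / 2), fderiv ℂ M x = 0 := by
      intro x hx
      have dD : HasFDerivAt D (fderiv ℂ D x) x :=
        (hF.fderiv _ (hxU (hsub hx))).differentiableAt.hasFDerivAt
      have hev : (fun y => (M y).comp (A.comp (D y))) =ᶠ[𝓝 x] D := by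
        filter_upwards [Metric.isOpen_ball.mem_nhds hx] with y hy using hMD y hy
      have hprod := (hMd x hx).hasFDerivAt.clm_comp
        ((hasFDerivAt_const A x).clm_comp dD)
      have heq := hprod.unique (dD.congr_of_eventuallyEq hev)
      ext v w : 2
      obtain ⟨u, hu⟩ := (hball x (hsub hx)).2.1
      -- every `w` is of the form `A D w'`
      have hw : A (D x (Ring.inverse (A.comp (D x)) w)) = w := by
        have h1 : A.comp (D x) * Ring.inverse (A.comp (D x)) = 1 :=
          Ring.mul_inverse_cancel _ (hball x (hsub hx)).2.1
        exact DFunLike.congr_fun h1 w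
      set w' := Ring.inverse (A.comp (D x)) w
      have h3 := DFunLike.congr_fun (DFunLike.congr_fun heq v) w'
      have h4 := htan x hx v w'
      simp [normalProj, sub_eq_zero] at h3 h4
      rw [hw] at h3
      simp only [M, ContinuousLinearMap.comp_apply, D] at h3
      rw [← h4] at h3
      simpa using h3
    have hMc : ∀ x ∈ Metric.ball x₀ (r / 2), M x = M x₀ := fun x hx =>
      (convex_ball x₀ (r / 2)).is_const_of_fderivWithin_eq_zero (𝕜 := ℂ)
        (fun y hy => (hMd y hy).differentiableWithinAt)
        (fun y hy => by rw [fderivWithin_of_isOpen Metric.isOpen_ball hy, hM0 y hy])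
        hx (Metric.mem_ball_self (by linarith))
    have hM : M x₀ = D x₀ := by
      simp only [M]
      erw [hinv]
      rfl
    have hlin : ∀ x ∈ Metric.ball x₀ (r / 2),
        (fun x => F x - D x₀ (A (F x))) x = (fun x => F x - D x₀ (A (F x))) x₀ := by
      intro x hx
      have hder : ∀ y ∈ Metric.ball x₀ (r / 2),
          HasFDerivAt (fun x => F x - D x₀ (A (F x))) (0 : E →L[ℂ] (Fin n → ℂ)) y := by
        intro y hy
        have dF : HasFDerivAt F (D y) y := (hF _ (hxU (hsub hy))).differentiableAt.hasFDerivAt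
        have h1 := dF.sub (((D x₀).comp A).hasFDerivAt.comp y dF)
        have h2 := hMD y hy
        rw [hMc y hy, hM] at h2
        have h3 : D y - ((D x₀).comp A).comp (D y) = 0 := by
          rw [ContinuousLinearMap.comp_assoc, h2, sub_self]
        rw [h3] at h1
        exact h1
      exact (convex_ball x₀ (r / 2)).is_const_of_fderivWithin_eq_zero (𝕜 := ℂ)
        (fun y hy => (hder y hy).differentiableAt.differentiableWithinAt)
        (fun y hy => by rw [fderivWithin_of_isOpen Metric.isOpen_ball hy, (hder y hy).fderiv])
        hx (Metric.mem_ball_self (by linarith))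
    filter_upwards [Metric.ball_mem_nhds x₀ (half_pos hr)] with x hx
    have h := hlin x hx
    simp only [h0, map_zero, sub_zero] at h
    exact sub_eq_zero.1 h
  · intro a b c
    let D₀ := fderiv ℂ F x₀
    -- `τ = 0`, `σ = 1`
    have hconj : ∀ ξ : E, ‖ξ‖ < r / 2 →
        normalProj A D₀ (fun j => star (F (x₀ + ξ) j) * (D₀ a j * D₀ b j)) = 0 := by
      intro ξ hξ
      have h := hpol hξ a b (τ := 0) (σ := 1) (by simp) (by simp)
      rw [zero_smul, add_zero, htan x₀ (Metric.mem_ball_self (by linarith)), h0,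
        connectionTerm_zero_left] at h
      simpa using h.symm
    let Λ : (Fin n → ℂ) →L[ℝ] (Fin n → ℂ) :=
      ((normalProj A D₀).restrictScalars ℝ).comp (ContinuousLinearMap.pi fun j =>
        (ContinuousLinearMap.mul ℝ ℂ).flip (D₀ a j * D₀ b j) ∘L
          (Complex.conjCLE : ℂ →L[ℝ] ℂ) ∘L ContinuousLinearMap.proj j)
    have hΛ : ∀ z, Λ z = normalProj A D₀ (fun j => star (z j) * (D₀ a j * D₀ b j)) := by
      intro z
      simp only [Λ, ContinuousLinearMap.comp_apply, ContinuousLinearMap.coe_restrictScalars']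
      congr 1
    have hd1 : HasDerivAt (fun t : ℝ => F (x₀ + t • c)) (D₀ c) 0 := by
      have hl : HasDerivAt (fun t : ℝ => x₀ + t • c) c 0 := by
        simpa using ((hasDerivAt_id (0 : ℝ)).smul_const c).const_add x₀
      have hf : HasFDerivAt F (D₀.restrictScalars ℝ) (x₀ + (0 : ℝ) • c) := by
        simpa using (hF _ hx₀).differentiableAt.hasFDerivAt.restrictScalars ℝ
      exact hf.comp_hasDerivAt (0 : ℝ) hl
    have hd2 := Λ.hasFDerivAt.comp_hasDerivAt (0 : ℝ) hd1
    have hz : (Λ ∘ fun t : ℝ => F (x₀ + t • c)) =ᶠ[𝓝 0] fun _ => 0 := by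
      have hc : ContinuousAt (fun t : ℝ => ‖t • c‖) 0 := by fun_prop
      filter_upwards [hc.eventually_lt_const (u := r / 2) (by simpa using hr)] with t ht
      rw [Function.comp_apply, hΛ, hconj _ ht]
    have h5 : Λ (D₀ c) = 0 := hd2.unique ((hasDerivAt_const (0 : ℝ) _).congr_of_eventuallyEq hz)
    rw [hΛ] at h5
    refine ⟨A (fun j => star (D₀ c j) * (D₀ a j * D₀ b j)), ?_⟩
    have h6 : (fun j => star (D₀ c j) * (D₀ a j * D₀ b j)) =
        D₀ (A (fun j => star (D₀ c j) * (D₀ a j * D₀ b j))) := by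
      have h7 : (fun j => star (D₀ c j) * (D₀ a j * D₀ b j)) -
        D₀ ((Ring.inverse (A.comp D₀)) (A (fun j => star (D₀ c j) * (D₀ a j * D₀ b j)))) = 0 := h5
      rw [hinv] at h7
      exact sub_eq_zero.1 h7
    rw [show fderiv ℂ F x₀ = D₀ from rfl, ← h6]
    funext j
    rw [mul_comm]
    rfl

end Local

/-! ### The Levi-Civita connection of the product of cigars -/

theorem fderiv_cigarMetric (n : ℕ) (p v w u : Fin n → ℂ) :
    fderiv ℝ (fun q => cigarMetric n q w u) p v =
      ∑ j, -(2 * ((p j).re * (v j).re + (p j).im * (v j).im)) *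
        ((w j).re * (u j).re + (w j).im * (u j).im) / (1 + ‖p j‖ ^ 2) ^ 2 := by
  have hpos : ∀ (q : Fin n → ℂ) j, 1 + ‖q j‖ ^ 2 ≠ 0 := fun q j => by positivity
  have hd : DifferentiableAt ℝ (fun q => cigarMetric n q w u) p := by
    simp only [cigarMetric, div_eq_mul_inv]
    refine DifferentiableAt.fun_sum fun j _ => ?_
    have h1 : DifferentiableAt ℝ (fun q : Fin n → ℂ => ‖q j‖ ^ 2) p :=
      (differentiableAt_apply j p).norm_sq ℝ
    exact (differentiableAt_const _).fun_mul ((h1.const_add 1).fun_inv (hpos p j))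
  have hl : HasDerivAt (fun x : ℝ => p + x • v) v 0 := by
    simpa using ((hasDerivAt_id (0 : ℝ)).smul_const v).const_add p
  have hd' : HasFDerivAt (fun q => cigarMetric n q w u)
      (fderiv ℝ (fun q => cigarMetric n q w u) p) (p + (0 : ℝ) • v) := by
    simpa using hd.hasFDerivAt
  have h1 := hd'.comp_hasDerivAt (0 : ℝ) hl
  refine h1.unique ?_
  show HasDerivAt (fun x : ℝ => ∑ j, ((w j).re * (u j).re + (w j).im * (u j).im) /
    (1 + ‖p j + x • v j‖ ^ 2)) _ 0
  refine HasDerivAt.fun_sum fun j _ => ?_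
  have hlj : HasDerivAt (fun x : ℝ => p j + x • v j) (v j) 0 := by
    simpa using ((hasDerivAt_id (0 : ℝ)).smul_const (v j)).const_add (p j)
  have hsq : HasDerivAt (fun x : ℝ => 1 + ‖p j + x • v j‖ ^ 2)
      (2 * ((p j).re * (v j).re + (p j).im * (v j).im)) 0 := by
    have := hlj.norm_sq.const_add 1
    simpa [Complex.inner, mul_comm] using this
  have h2 := (hasDerivAt_const (0 : ℝ) ((w j).re * (u j).re + (w j).im * (u j).im)).fun_div hsq
    (by positivity)
  convert! h2 using 1
  simp
  ring

/-- The metric being Kähler, its Christoffel term is complex bilinear: `Γ_j(v, w)` is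
`-p̄_j v_j w_j / (1 + |p_j|²)`. -/
theorem christoffel_cigarMetric (n : ℕ) (p v w u : Fin n → ℂ) :
    christoffel (cigarMetric n) p v w u =
      -cigarMetric n p (connectionTerm p (star p) v w) u := by
  rw [christoffel, fderiv_cigarMetric, fderiv_cigarMetric, fderiv_cigarMetric, cigarMetric,
    ← Finset.sum_add_distrib, ← Finset.sum_sub_distrib, Finset.mul_sum, ← Finset.sum_neg_distrib]
  refine Finset.sum_congr rfl fun j _ => ?_
  have h : 1 + ‖p j‖ ^ 2 ≠ 0 := by positivity
  have hc : connectionTerm p (star p) v w j =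
      (((1 + ‖p j‖ ^ 2)⁻¹ : ℝ) : ℂ) * (starRingEnd ℂ (p j) * (v j * w j)) := by
    have := Complex.mul_conj' (p j)
    simp only [connectionTerm, Pi.star_apply, Complex.star_def, this]
    push_cast
    ring
  rw [hc, Complex.re_ofReal_mul, Complex.im_ofReal_mul]
  simp
  field_simp
  ring

/-- The real part of a complex linear functional is the `cigarMetric`-product with some vector. -/
theorem exists_cigarMetric_eq_re {n : ℕ} (z : Fin n → ℂ) (l : (Fin n → ℂ) →L[ℂ] ℂ) :
    ∃ u, ∀ a, cigarMetric n z a u = (l a).re := by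
  refine ⟨fun j => ((1 + ‖z j‖ ^ 2 : ℝ) : ℂ) * starRingEnd ℂ (l (Pi.single j 1)), fun a => ?_⟩
  have h : l a = ∑ j, a j * l (Pi.single j 1) := by
    conv_lhs => rw [pi_eq_sum_univ' a]
    rw [map_sum]
    refine Finset.sum_congr rfl fun j _ => ?_
    rw [map_smul, smul_eq_mul]
  rw [h, Complex.re_sum, cigarMetric]
  refine Finset.sum_congr rfl fun j _ => ?_
  have h : 1 + ‖z j‖ ^ 2 ≠ 0 := by positivity
  rw [Complex.re_ofReal_mul, Complex.im_ofReal_mul]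
  simp
  field_simp
  ring

theorem cigarMetric_sub {n : ℕ} (z a b u : Fin n → ℂ) :
    cigarMetric n z (a - b) u = cigarMetric n z a u - cigarMetric n z b u := by
  simp only [cigarMetric, ← Finset.sum_sub_distrib]
  refine Finset.sum_congr rfl fun j _ => ?_
  simp
  ring

section Charts

variable {n k : ℕ} {S : Type*} [TopologicalSpace S] [ChartedSpace (Fin k → ℂ) S]

theorem analyticOnNhd_chart [IsManifold 𝓘(ℂ, Fin k → ℂ) ω S] {f : S → Fin n → ℂ}
    (hf : IsHolomorphicImmersion k f) {e : OpenPartialHomeomorph S (Fin k → ℂ)}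
    (he : e ∈ atlas (Fin k → ℂ) S) : AnalyticOnNhd ℂ (f ∘ e.symm) e.target := by
  have h1 : ContMDiffOn 𝓘(ℂ, Fin k → ℂ) 𝓘(ℂ, Fin n → ℂ) ω (f ∘ e.symm) e.target :=
    hf.holomorphic.comp_contMDiffOn (contMDiffOn_symm_of_mem_maximalAtlas
      (IsManifold.subset_maximalAtlas he))
  have h2 := contMDiffOn_iff_contDiffOn.1 h1
  intro x hx
  exact (h2.contDiffAt (e.open_target.mem_nhds hx)).analyticAt

theorem injective_fderiv_chart [IsManifold 𝓘(ℂ, Fin k → ℂ) ω S] {f : S → Fin n → ℂ}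
    (hf : IsHolomorphicImmersion k f) (p : S) :
    Function.Injective (fderiv ℂ (f ∘ (chartAt (Fin k → ℂ) p).symm) (chartAt (Fin k → ℂ) p p)) := by
  have h := hf.injective_mfderiv p
  have hd : MDifferentiableAt 𝓘(ℂ, Fin k → ℂ) 𝓘(ℂ, Fin n → ℂ) f p :=
    hf.holomorphic.mdifferentiableAt (by simp)
  have h2 : (mfderiv 𝓘(ℂ, Fin k → ℂ) 𝓘(ℂ, Fin n → ℂ) f p : (Fin k → ℂ) →L[ℂ] (Fin n → ℂ)) =
      fderiv ℂ (f ∘ (chartAt (Fin k → ℂ) p).symm) (chartAt (Fin k → ℂ) p p) := by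
    refine hd.mfderiv.trans ?_
    simp only [mfld_simps, fderivWithin_univ]
    rfl
  rw [← h2]
  exact h

theorem holomorphicallyGeodesic_chart [IsManifold 𝓘(ℂ, Fin k → ℂ) ω S] {f : S → Fin n → ℂ}
    (hf : IsHolomorphicImmersion k f) (hg : IsTotallyGeodesic k (cigarMetric n) f)
    {e : OpenPartialHomeomorph S (Fin k → ℂ)} (he : e ∈ atlas (Fin k → ℂ) S) :
    HolomorphicallyGeodesic (f ∘ e.symm) e.target := by
  intro x hx
  set F := f ∘ e.symm with hFdef
  have hF := analyticOnNhd_chart hf he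
  have hfd : ∀ y ∈ e.target, fderiv ℝ F y = (fderiv ℂ F y).restrictScalars ℝ := fun y hy =>
    (hF y hy).differentiableAt.fderiv_restrictScalars ℝ
  have hfd2 : ∀ v w, fderiv ℝ (fun y => fderiv ℝ F y w) x v = fderiv ℂ (fderiv ℂ F) x v w := by
    intro v w
    have hev : (fun y => fderiv ℝ F y w) =ᶠ[𝓝 x] fun y => fderiv ℂ F y w := by
      filter_upwards [e.open_target.mem_nhds hx] with y hy
      rw [hfd y hy]
      rfl
    have h1 : HasFDerivAt (fun y => fderiv ℂ F y w) ((fderiv ℂ (fderiv ℂ F) x).flip w) x := by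
      have := ((hF.fderiv x hx).differentiableAt.hasFDerivAt).clm_apply
        (hasFDerivAt_const w x)
      simpa using this
    rw [hev.fderiv_eq, (h1.restrictScalars ℝ).fderiv]
    rfl
  have hre : ∀ l : (Fin n → ℂ) →L[ℂ] ℂ, (∀ a, l (fderiv ℂ F x a) = 0) → ∀ v w,
      (l (fderiv ℂ (fderiv ℂ F) x v w -
        connectionTerm (F x) (star (F x)) (fderiv ℂ F x v) (fderiv ℂ F x w))).re = 0 := by
    intro l hl v w
    obtain ⟨u, hu⟩ := exists_cigarMetric_eq_re (F x) l
    have h := hg e he x hx u (fun a => by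
      show cigarMetric n (F x) (fderiv ℝ F x a) u = 0
      rw [hfd x hx, hu]
      simp [hl]) v w
    rw [christoffel_cigarMetric, ← hFdef, hfd2, ← sub_eq_add_neg, ← cigarMetric_sub, hu,
      hfd x hx] at h
    exact h
  intro l hl v w
  rw [← sub_eq_zero, ← map_sub]
  -- the imaginary part of `l` is minus the real part of `i l`
  refine Complex.ext (hre l hl v w) ?_
  have h := hre (Complex.I • l) (fun a => by simp [hl]) v w
  simp at h ⊢
  linarith

end Charts

/-! ### Lifting a segment -/

section Lifting

variable {S V : Type*} [TopologicalSpace S] [NormedAddCommGroup V] [NormedSpace ℝ V]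

/-- The curve `s ↦ s v` on `[t, t']` has a continuous lift through `f` from `q` to `q'`. -/
def LiftsTo (f : S → V) (v : V) (q q' : S) (t t' : ℝ) : Prop :=
  t ≤ t' ∧ ∃ γ : ℝ → S, ContinuousOn γ (Icc t t') ∧ γ t = q ∧ γ t' = q' ∧
    ∀ s ∈ Icc t t', f (γ s) = s • v

theorem LiftsTo.refl {f : S → V} {v : V} {q : S} {t : ℝ} (h : f q = t • v) :
    LiftsTo f v q q t t :=
  ⟨le_rfl, fun _ => q, continuousOn_const, rfl, rfl, fun s hs => by
    rw [Icc_self, mem_singleton_iff] at hs; rw [hs, h]⟩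

theorem LiftsTo.trans {f : S → V} {v : V} {q₁ q₂ q₃ : S} {t₁ t₂ t₃ : ℝ}
    (h : LiftsTo f v q₁ q₂ t₁ t₂) (h' : LiftsTo f v q₂ q₃ t₂ t₃) : LiftsTo f v q₁ q₃ t₁ t₃ := by
  obtain ⟨h1, γ, hγ, hγ1, hγ2, hγf⟩ := h
  obtain ⟨h2, δ, hδ, hδ1, hδ2, hδf⟩ := h'
  refine ⟨h1.trans h2, fun s => if s ≤ t₂ then γ s else δ s, ?_, by simp [h1, hγ1], ?_, ?_⟩
  · refine ContinuousOn.if ?_ ?_ ?_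
    · rintro s ⟨-, hs⟩
      have hs2 : s = t₂ := by
        have := frontier_le_subset_eq continuous_id continuous_const hs
        simpa using this
      rw [hs2, hγ2, hδ1]
    · refine hγ.mono ?_
      rintro s ⟨hs, hs'⟩
      rw [show {a : ℝ | a ≤ t₂} = Iic t₂ from rfl, closure_Iic] at hs'
      exact ⟨hs.1, hs'⟩
    · refine hδ.mono ?_
      rintro s ⟨hs, hs'⟩
      have : {a : ℝ | ¬ a ≤ t₂} = Ioi t₂ := by ext; simp
      rw [this, closure_Ioi] at hs'
      exact ⟨hs', hs.2⟩
  · rcases h2.eq_or_lt with rfl | h3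
    · simp [hγ2, ← hδ2, hδ1]
    · simp [h3.not_ge, hδ2]
  · intro s hs
    by_cases h3 : s ≤ t₂
    · simpa [h3] using hγf s ⟨hs.1, h3⟩
    · simpa [h3] using hδf s ⟨(not_le.1 h3).le, hs.2⟩

theorem LiftsTo.eq_right {f : S → V} {v : V} {q q' : S} {t t' : ℝ} (h : LiftsTo f v q q' t t') :
    f q' = t' • v := by
  obtain ⟨h1, γ, -, -, h2, h3⟩ := h
  rw [← h2]
  exact h3 t' ⟨h1, le_rfl⟩

/-- A local section of `f` over the line `ℝ v` lifts short segments that end at a given point or start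
from it. -/
theorem LiftsTo.exists_local {f : S → V} {v : V} {q : S} {t : ℝ} (hq : f q = t • v)
    (hsec : ∃ σ : V → S, ∃ O ∈ 𝓝 (f q), ContinuousOn σ O ∧
      (∀ z ∈ O, ∀ s : ℝ, z = s • v → f (σ z) = z) ∧ ∀ᶠ q' in 𝓝 q, σ (f q') = q') :
    ∃ ε > 0, (∀ δ, 0 ≤ δ → δ ≤ ε → ∃ q', LiftsTo f v q q' t (t + δ)) ∧
      ∀ᶠ q' in 𝓝 q, ∀ t', t - ε < t' → t' ≤ t → f q' = t' • v → LiftsTo f v q' q t' t := by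
  obtain ⟨σ, O, hO, hσ, hfσ, hσf⟩ := hsec
  have hc : ContinuousAt (fun s : ℝ => s • v) t := by fun_prop
  have hO' : (fun s : ℝ => s • v) ⁻¹' O ∈ 𝓝 t := hc (by rwa [hq] at hO)
  obtain ⟨ε, hε, hball⟩ := Metric.mem_nhds_iff.1 hO'
  have hmem : ∀ s, t - ε < s → s < t + ε → s • v ∈ O := fun s h1 h2 =>
    hball (by rw [Metric.mem_ball, Real.dist_eq, abs_lt]; constructor <;> linarith)
  have key : ∀ a b, t - ε < a → a ≤ b → b < t + ε →
      LiftsTo f v (σ (a • v)) (σ (b • v)) a b := by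
    intro a b ha hab hb
    refine ⟨hab, fun s => σ (s • v), ?_, rfl, rfl, fun s hs =>
      hfσ _ (hmem s (by linarith [hs.1]) (by linarith [hs.2])) s rfl⟩
    exact hσ.comp (by fun_prop) fun s hs => hmem s (by linarith [hs.1]) (by linarith [hs.2])
  have hqq : σ (t • v) = q := by rw [← hq]; exact hσf.self_of_nhds
  refine ⟨ε / 2, by positivity, fun δ h0 h1 => ⟨σ ((t + δ) • v), ?_⟩, ?_⟩
  · have := key t (t + δ) (by linarith) (by linarith) (by linarith)
    rwa [hqq] at this
  · filter_upwards [hσf] with q' hq' t' h1 h2 h3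
    have := key t' t (by linarith) h2 (by linarith)
    rwa [hqq, ← h3, hq'] at this

/-- If `f` has local sections over the line `ℝ v` and chains of lifts over `[0, 1]` converge, then `v` is
a value of `f`. A chain is built greedily, each step covering at least half of what can still be
covered; the limit of the chain then cannot be continued, so it lies over `v`. -/
theorem exists_eq_of_liftsTo {f : S → V} (hf : Continuous f) {v : V} {p₀ : S} (h0 : f p₀ = 0)
    (hsec : ∀ q, ∃ σ : V → S, ∃ O ∈ 𝓝 (f q), ContinuousOn σ O ∧
      (∀ z ∈ O, ∀ s : ℝ, z = s • v → f (σ z) = z) ∧ ∀ᶠ q' in 𝓝 q, σ (f q') = q')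
    (hlim : ∀ (p : ℕ → S) (t : ℕ → ℝ), (∀ i j, i ≤ j → LiftsTo f v (p i) (p j) (t i) (t j)) →
      (∀ i, t i ∈ Icc (0 : ℝ) 1) → ∃ q, Tendsto p atTop (𝓝 q)) :
    ∃ q, f q = v := by
  let X := {x : S × ℝ // f x.1 = x.2 • v ∧ 0 ≤ x.2 ∧ x.2 ≤ 1}
  let R : X → Set ℝ := fun x => {t' | t' ≤ 1 ∧ ∃ q', LiftsTo f v x.1.1 q' x.1.2 t'}
  have hR1 : ∀ x, BddAbove (R x) := fun x => ⟨1, fun t' h => h.1⟩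
  have hRmem : ∀ x : X, x.1.2 ∈ R x := fun x => ⟨x.2.2.2, x.1.1, LiftsTo.refl x.2.1⟩
  have hstep : ∀ x : X, ∃ y : X, LiftsTo f v x.1.1 y.1.1 x.1.2 y.1.2 ∧
      (x.1.2 + sSup (R x)) / 2 ≤ y.1.2 := by
    intro x
    rcases (le_csSup (hR1 x) (hRmem x)).eq_or_lt with h | h
    · exact ⟨x, LiftsTo.refl x.2.1, by linarith⟩
    · obtain ⟨t', ⟨ht', q', hq'⟩, hlt⟩ :=
        exists_lt_of_lt_csSup ⟨_, hRmem x⟩ (show (x.1.2 + sSup (R x)) / 2 < sSup (R x) by linarith)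
      exact ⟨⟨(q', t'), hq'.eq_right, x.2.2.1.trans hq'.1, ht'⟩, hq', hlt.le⟩
  choose next hnext1 hnext2 using hstep
  let x : ℕ → X := fun i => next^[i] ⟨(p₀, 0), by simp [h0], le_rfl, zero_le_one⟩
  have hx : ∀ i, x (i + 1) = next (x i) := fun i => Function.iterate_succ_apply' _ _ _
  have hchain : ∀ i j, i ≤ j → LiftsTo f v (x i).1.1 (x j).1.1 (x i).1.2 (x j).1.2 := by
    intro i j hij
    induction j, hij using Nat.le_induction with
    | base => exact LiftsTo.refl (x i).2.1
    | succ j _ ih => rw [hx j]; exact ih.trans (hnext1 _)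
  obtain ⟨q, hq⟩ := hlim (fun i => (x i).1.1) (fun i => (x i).1.2) hchain fun i => (x i).2.2
  have hmono : Monotone fun i => (x i).1.2 := fun i j hij => (hchain i j hij).1
  have hbdd : BddAbove (range fun i => (x i).1.2) := ⟨1, by rintro _ ⟨i, rfl⟩; exact (x i).2.2.2⟩
  set T := ⨆ i, (x i).1.2
  have hT : Tendsto (fun i => (x i).1.2) atTop (𝓝 T) := tendsto_atTop_ciSup hmono hbdd
  have hT1 : T ≤ 1 := ciSup_le fun i => (x i).2.2.2
  have hle : ∀ i, (x i).1.2 ≤ T := fun i => le_ciSup hbdd i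
  have hfq : f q = T • v := by
    refine tendsto_nhds_unique ((hf.tendsto q).comp hq) ?_
    exact (hT.smul_const v).congr fun i => (x i).2.1.symm
  rcases hT1.eq_or_lt with h | h
  · exact ⟨q, by rw [hfq, h, one_smul]⟩
  exfalso
  obtain ⟨ε, hε, hfwd, hback⟩ := LiftsTo.exists_local hfq (hsec q)
  obtain ⟨q', hq'⟩ := hfwd (min ε (1 - T)) (le_min hε.le (by linarith)) (min_le_left _ _)
  have hδ : 0 < min ε (1 - T) := lt_min hε (by linarith)
  have hev : ∀ᶠ i in atTop, ((x i).1.2 + (T + min ε (1 - T))) / 2 ≤ T := by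
    filter_upwards [hq.eventually hback, hT.eventually (lt_mem_nhds (show T - ε < T by linarith))]
      with i hi1 hi2
    have hl := (hi1 _ hi2 (hle i) (x i).2.1).trans hq'
    have hm : T + min ε (1 - T) ∈ R (x i) :=
      ⟨by linarith [min_le_right ε (1 - T)], q', hl⟩
    have h1 := le_csSup (hR1 _) hm
    have h2 := hnext2 (x i)
    have h3 := hle (i + 1)
    rw [hx i] at h3
    linarith
  have hlim2 : Tendsto (fun i => ((x i).1.2 + (T + min ε (1 - T))) / 2) atTop
      (𝓝 ((T + (T + min ε (1 - T))) / 2)) := (hT.add_const _).div_const 2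
  have := le_of_tendsto hlim2 hev
  linarith

end Lifting

/-! ### Immersions into a subspace of the same dimension -/

section Immersion

variable {n k : ℕ} {S : Type*} [TopologicalSpace S] [ChartedSpace (Fin k → ℂ) S]
  [IsManifold 𝓘(ℂ, Fin k → ℂ) ω S] {f : S → Fin n → ℂ}

/-- The identity theorem on a connected manifold. -/
theorem clm_comp_eq_zero [ConnectedSpace S] (hf : IsHolomorphicImmersion k f)
    (Q : (Fin n → ℂ) →L[ℂ] (Fin n → ℂ)) {p₀ : S} (h0 : ∀ᶠ p in 𝓝 p₀, Q (f p) = 0) (p : S) :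
    Q (f p) = 0 := by
  let Z : Set S := {p | ∀ᶠ q in 𝓝 p, Q (f q) = 0}
  have hopen : IsOpen Z := isOpen_setOfPred_eventually_nhds
  have hclosed : IsClosed Z := by
    refine isClosed_of_closure_subset fun p hp => ?_
    let e := chartAt (Fin k → ℂ) p
    have hep : e p ∈ e.target := mem_chart_target _ p
    obtain ⟨r, hr, hball⟩ := Metric.isOpen_iff.1 e.open_target _ hep
    have hN : e.source ∩ e ⁻¹' Metric.ball (e p) r ∈ 𝓝 p :=
      (e.isOpen_inter_preimage Metric.isOpen_ball).mem_nhds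
        ⟨mem_chart_source _ p, Metric.mem_ball_self hr⟩
    obtain ⟨q, ⟨hqs, hqb⟩, hqZ⟩ := mem_closure_iff_nhds.1 hp _ hN
    have ha : AnalyticOnNhd ℂ (fun x => Q (f (e.symm x))) (Metric.ball (e p) r) := fun x hx =>
      (Q.analyticAt _).comp (analyticOnNhd_chart hf (chart_mem_atlas _ p) x (hball hx))
    have hev : (fun x => Q (f (e.symm x))) =ᶠ[𝓝 (e q)] 0 := by
      have hc : Tendsto e.symm (𝓝 (e q)) (𝓝 q) := by
        have := e.continuousAt_symm (hball hqb)
        rwa [ContinuousAt, e.left_inv hqs] at this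
      exact hc.eventually hqZ
    have hz := ha.eqOn_zero_of_preconnected_of_eventuallyEq_zero
      (convex_ball _ r).isPreconnected hqb hev
    show ∀ᶠ q in 𝓝 p, Q (f q) = 0
    filter_upwards [hN] with q' hq'
    have := hz hq'.2
    simpa [e.left_inv hq'.1] using this
  have : Z = univ := IsClopen.eq_univ ⟨hclosed, hopen⟩ ⟨p₀, h0⟩
  exact (this ▸ mem_univ p : p ∈ Z).self_of_nhds

/-- For an immersion into a subspace `V` of dimension `k`, the chart at `q` is near `q` a smooth function
`g` of `f`, and `g` gives a local section of `f` over `V`. -/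
theorem exists_chart_eq_comp (hf : IsHolomorphicImmersion k f) {V : Submodule ℂ (Fin n → ℂ)}
    (hV : Module.finrank ℂ V = k) (hfV : ∀ p, f p ∈ V) (q : S) :
    ∃ g : (Fin n → ℂ) → (Fin k → ℂ), ContDiffAt ℝ 1 g (f q) ∧
      (∀ᶠ q' in 𝓝 q, g (f q') = chartAt (Fin k → ℂ) q q') ∧
      ∃ O ∈ 𝓝 (f q), ContinuousOn ((chartAt (Fin k → ℂ) q).symm ∘ g) O ∧
        ∀ z ∈ O, z ∈ V → f ((chartAt (Fin k → ℂ) q).symm (g z)) = z := by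
  let e := chartAt (Fin k → ℂ) q
  let F := f ∘ e.symm
  have hx : e q ∈ e.target := mem_chart_target _ q
  have hqe : e.symm (e q) = q := e.left_inv (mem_chart_source _ q)
  have hF : AnalyticOnNhd ℂ F e.target := analyticOnNhd_chart hf (chart_mem_atlas _ q)
  let D := fderiv ℂ F (e q)
  have hD : HasFDerivAt F D (e q) := (hF _ hx).differentiableAt.hasFDerivAt
  have hinj : Function.Injective D := injective_fderiv_chart hf q
  have hDV : ∀ a, D a ∈ V := by
    intro a
    have hl : HasDerivAt (fun t : ℂ => e q + t • a) a 0 := by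
      simpa using ((hasDerivAt_id (0 : ℂ)).smul_const a).const_add (e q)
    have hD' : HasFDerivAt F D (e q + (0 : ℂ) • a) := by simpa using hD
    have hd := hD'.comp_hasDerivAt (0 : ℂ) hl
    rw [hasDerivAt_iff_tendsto_slope] at hd
    refine V.closed_of_finiteDimensional.mem_of_tendsto hd (Eventually.of_forall fun t => ?_)
    exact V.smul_mem _ (V.sub_mem (hfV _) (hfV _))
  have hrange : LinearMap.range (D : (Fin k → ℂ) →ₗ[ℂ] (Fin n → ℂ)) = V := by
    refine Submodule.eq_of_le_of_finrank_eq ?_ ?_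
    · rintro _ ⟨a, rfl⟩
      exact hDV a
    · rw [LinearMap.finrank_range_of_inj hinj, hV]
      simp
  obtain ⟨A₀, hA₀⟩ := LinearMap.exists_leftInverse_of_injective
    (D : (Fin k → ℂ) →ₗ[ℂ] (Fin n → ℂ)) (LinearMap.ker_eq_bot.2 hinj)
  let A : (Fin n → ℂ) →L[ℂ] (Fin k → ℂ) := LinearMap.toContinuousLinearMap A₀
  have hAD : ∀ a, A (D a) = a := fun a => DFunLike.congr_fun hA₀ a
  have hAinj : ∀ y ∈ V, ∀ z ∈ V, A y = A z → y = z := by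
    intro y hy z hz h
    rw [← hrange] at hy hz
    obtain ⟨a, rfl⟩ := hy
    obtain ⟨b, rfl⟩ := hz
    have h' : A (D a) = A (D b) := h
    rw [hAD, hAD] at h'
    rw [h']
  have hc : ContDiffAt ℂ 1 (fun x => A (F x)) (e q) :=
    A.contDiff.contDiffAt.comp (e q) (hF _ hx).contDiffAt
  have hd : HasFDerivAt (fun x => A (F x))
      ((ContinuousLinearEquiv.refl ℂ (Fin k → ℂ) : (Fin k → ℂ) ≃L[ℂ] (Fin k → ℂ)) :
        (Fin k → ℂ) →L[ℂ] (Fin k → ℂ)) (e q) := by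
    convert! A.hasFDerivAt.comp (e q) hD using 1
    ext1 a
    exact (hAD a).symm
  let h := hc.toOpenPartialHomeomorph (fun x => A (F x)) hd (by simp)
  have hcoe : ∀ x, h x = A (F x) := fun x => rfl
  have hsrc : e q ∈ h.source := hc.mem_toOpenPartialHomeomorph_source hd (by simp)
  have hAq : A (f q) = h (e q) := by rw [hcoe]; simp only [F, Function.comp_apply, hqe]
  have htgt : A (f q) ∈ h.target := hAq ▸ h.map_source hsrc
  have hg0 : h.symm (A (f q)) = e q := by rw [hAq, h.left_inv hsrc]
  refine ⟨fun z => h.symm (A z), ?_, ?_, A ⁻¹' (h.target ∩ h.symm ⁻¹' e.target), ?_, ?_, ?_⟩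
  · have h1 : ContDiffAt ℂ 1 h.symm (A (f q)) := by
      have := hc.to_localInverse hd (by simp)
      simp only [F, Function.comp_apply, hqe] at this
      exact this
    exact (h1.comp (f q) A.contDiff.contDiffAt).restrict_scalars ℝ
  · have hcont : ContinuousAt e q := e.continuousAt (mem_chart_source _ q)
    filter_upwards [e.open_source.mem_nhds (mem_chart_source _ q),
      hcont.eventually (h.open_source.eventually_mem hsrc)] with q' h1 h2
    have h3 := h.left_inv h2
    rw [hcoe] at h3
    simp only [F, Function.comp_apply, e.left_inv h1] at h3
    exact h3
  · refine A.continuous.continuousAt.preimage_mem_nhds ?_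
    refine (h.isOpen_inter_preimage_symm e.open_target).mem_nhds ⟨htgt, ?_⟩
    rw [mem_preimage, hg0]
    exact hx
  · refine e.continuousOn_symm.comp (h.continuousOn_symm.comp A.continuous.continuousOn
      fun z hz => hz.1) fun z hz => hz.2
  · intro z hz hzV
    have h1 : A (F (h.symm (A z))) = A z := by rw [← hcoe]; exact h.right_inv hz.1
    exact hAinj _ (hfV _) z hzV h1

/-- A continuous lift of a segment is `C¹`, and the metric is at most the Euclidean one, so the induced
distance of two of its points is controlled by the parameters. -/
theorem inducedDist_le_of_lift (hf : IsHolomorphicImmersion k f) {V : Submodule ℂ (Fin n → ℂ)}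
    (hV : Module.finrank ℂ V = k) (hfV : ∀ p, f p ∈ V) {v : Fin n → ℂ} {t t' : ℝ} {γ : ℝ → S}
    (hγ : ContinuousOn γ (Icc t t')) (hfγ : ∀ s ∈ Icc t t', f (γ s) = s • v)
    {a b : ℝ} (ha : a ∈ Icc t t') (hb : b ∈ Icc t t') :
    inducedDist k (cigarMetric n) f (γ a) (γ b) ≤
      ENNReal.ofReal (|b - a| * Real.sqrt (∑ j, ‖v j‖ ^ 2)) := by
  let c : ℝ → ℝ := fun s => a + s * (b - a)
  have hc : ∀ s ∈ Icc (0 : ℝ) 1, c s ∈ Icc t t' := by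
    intro s hs
    have : c s = (1 - s) • a + s • b := by simp [c]; ring
    rw [this]
    exact convex_Icc t t' ha hb (by linarith [hs.2]) hs.1 (by ring)
  have hccont : ContinuousOn (γ ∘ c) (Icc 0 1) := hγ.comp (by fun_prop) hc
  have hsmooth : ContMDiffOn 𝓘(ℝ, ℝ) 𝓘(ℝ, Fin k → ℂ) 1 (γ ∘ c) (Icc 0 1) := by
    intro s hs
    rw [contMDiffWithinAt_iff_target]
    refine ⟨hccont s hs, contMDiffWithinAt_iff_contDiffWithinAt.2 ?_⟩
    obtain ⟨g, hg, hgf, -⟩ := exists_chart_eq_comp hf hV hfV (γ (c s))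
    have hlin : ContDiffWithinAt ℝ 1 (fun s => c s • v) (Icc 0 1) s := by
      apply ContDiff.contDiffWithinAt
      fun_prop
    rw [hfγ _ (hc s hs)] at hg
    have h1 := hg.comp_contDiffWithinAt s hlin
    have h2 : (fun s' => chartAt (Fin k → ℂ) (γ (c s)) (γ (c s'))) =ᶠ[𝓝[Icc 0 1] s]
        (g ∘ fun s => c s • v) := by
      filter_upwards [(hccont s hs).eventually hgf, self_mem_nhdsWithin] with s' h3 h4
      rw [Function.comp_apply] at h3
      rw [← h3, Function.comp_apply, hfγ _ (hc s' h4)]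
    have h3 := h1.congr_of_eventuallyEq h2 (h2.self_of_nhdsWithin hs)
    simpa [mfld_simps, Function.comp_def] using! h3
  have hle : inducedDist k (cigarMetric n) f (γ a) (γ b) ≤
      curveLength (cigarMetric n) f (γ ∘ c) :=
    iInf₂_le_of_le (γ ∘ c) hsmooth <| iInf₂_le_of_le (by simp [c]) (by simp [c]) le_rfl
  refine hle.trans ?_
  rw [curveLength, ← restrict_Ioo_eq_restrict_Icc]
  have hbound : ∀ s ∈ Ioo (0 : ℝ) 1, ENNReal.ofReal (Real.sqrt (cigarMetric n (f ((γ ∘ c) s))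
      (deriv (f ∘ (γ ∘ c)) s) (deriv (f ∘ (γ ∘ c)) s))) ≤
      ENNReal.ofReal (|b - a| * Real.sqrt (∑ j, ‖v j‖ ^ 2)) := by
    intro s hs
    have hev : f ∘ (γ ∘ c) =ᶠ[𝓝 s] fun s => c s • v := by
      filter_upwards [Ioo_mem_nhds hs.1 hs.2] with s' hs'
      exact hfγ _ (hc s' ⟨hs'.1.le, hs'.2.le⟩)
    have hd : HasDerivAt (fun s => c s • v) ((b - a) • v) s := by
      have : HasDerivAt c (b - a) s := by
        have h := ((hasDerivAt_id s).mul_const (b - a)).const_add a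
        rw [one_mul] at h
        exact h
      exact this.smul_const v
    rw [hev.deriv_eq, hd.deriv]
    refine ENNReal.ofReal_le_ofReal ?_
    rw [← Real.sqrt_sq_eq_abs, ← Real.sqrt_mul (sq_nonneg _), Finset.mul_sum]
    refine Real.sqrt_le_sqrt (Finset.sum_le_sum fun j _ => ?_)
    have h1 : (1 : ℝ) ≤ 1 + ‖f ((γ ∘ c) s) j‖ ^ 2 := by
      have := sq_nonneg ‖f ((γ ∘ c) s) j‖
      linarith
    have h2 : ‖v j‖ ^ 2 = (v j).re ^ 2 + (v j).im ^ 2 := by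
      rw [← Complex.normSq_eq_norm_sq, Complex.normSq_apply]; ring
    refine (div_le_self ?_ h1).trans (le_of_eq ?_)
    · exact add_nonneg (mul_self_nonneg _) (mul_self_nonneg _)
    · rw [h2]
      simp
      ring
  refine (setLIntegral_mono measurable_const hbound).trans ?_
  simp

/-- A complete immersed manifold contained in a subspace `V` of the same dimension and passing through
`0` covers `V`: segments from `0` lift, their length being finite. -/
theorem range_eq_of_complete (hf : IsHolomorphicImmersion k f)
    (hc : IsCompleteInduced k (cigarMetric n) f) {V : Submodule ℂ (Fin n → ℂ)}
    (hV : Module.finrank ℂ V = k) (hfV : ∀ p, f p ∈ V) {p₀ : S} (h0 : f p₀ = 0) :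
    range f = V := by
  refine Subset.antisymm (range_subset_iff.2 hfV) fun v hv => ?_
  refine exists_eq_of_liftsTo hf.holomorphic.continuous h0 (fun q => ?_) fun p t hpt ht => ?_
  · obtain ⟨g, -, hgf, O, hO, hgO, hfg⟩ := exists_chart_eq_comp hf hV hfV q
    refine ⟨_, O, hO, hgO, fun z hz s hs => hfg z hz ?_, ?_⟩
    · rw [hs, ← Complex.coe_smul]
      exact V.smul_mem _ hv
    · filter_upwards [hgf, (chartAt (Fin k → ℂ) q).open_source.mem_nhds (mem_chart_source _ q)]
        with q' h1 h2
      rw [Function.comp_apply, h1, (chartAt (Fin k → ℂ) q).left_inv h2]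
  · set L := Real.sqrt (∑ j, ‖v j‖ ^ 2)
    have hdist : ∀ i j, inducedDist k (cigarMetric n) f (p i) (p j) ≤
        ENNReal.ofReal (|t j - t i| * L) := by
      intro i j
      rcases le_total i j with h | h
      · obtain ⟨h1, γ, hγ, h2, h3, h4⟩ := hpt i j h
        rw [← h2, ← h3]
        exact inducedDist_le_of_lift hf hV hfV hγ h4 ⟨le_rfl, h1⟩ ⟨h1, le_rfl⟩
      · obtain ⟨h1, γ, hγ, h2, h3, h4⟩ := hpt j i h
        rw [← h2, ← h3]
        exact inducedDist_le_of_lift hf hV hfV hγ h4 ⟨h1, le_rfl⟩ ⟨le_rfl, h1⟩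
    have hcauchy : CauchySeq t := by
      have hmono : Monotone t := fun i j hij => (hpt i j hij).1
      exact (tendsto_atTop_ciSup hmono ⟨1, by rintro _ ⟨i, rfl⟩; exact (ht i).2⟩).cauchySeq
    refine hc p fun ε hε => ?_
    obtain ⟨δ, hδ, hδε⟩ : ∃ δ : ℝ, 0 < δ ∧ ENNReal.ofReal (δ * L) < ε := by
      have hcont : ContinuousAt (fun δ : ℝ => ENNReal.ofReal (δ * L)) 0 := by
        have : Continuous fun δ : ℝ => ENNReal.ofReal (δ * L) :=
          ENNReal.continuous_ofReal.comp (by fun_prop)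
        exact this.continuousAt
      have hev := hcont.eventually_lt_const (u := ε) (by simpa using hε)
      obtain ⟨δ, hδ⟩ := ((hev.filter_mono (nhdsWithin_le_nhds (s := Ioi 0))).and
        self_mem_nhdsWithin).exists
      exact ⟨δ, hδ.2, hδ.1⟩
    obtain ⟨N, hN⟩ := Metric.cauchySeq_iff.1 hcauchy δ hδ
    refine ⟨N, fun l hl m hm => (hdist l m).trans_lt (lt_of_le_of_lt ?_ hδε)⟩
    have h1 := hN m hm l hl
    rw [Real.dist_eq] at h1
    exact ENNReal.ofReal_le_ofReal (mul_le_mul_of_nonneg_right h1.le (Real.sqrt_nonneg _))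

/-- A complete totally geodesic complex submanifold of the product of cigars through `0` is its tangent
space at `0`, and this space is stable under the componentwise product `a b c̄`. -/
theorem exists_range_eq [ConnectedSpace S] (hf : IsHolomorphicImmersion k f)
    (hg : IsTotallyGeodesic k (cigarMetric n) f) (hc : IsCompleteInduced k (cigarMetric n) f)
    (h0 : (0 : Fin n → ℂ) ∈ range f) :
    ∃ V : Submodule ℂ (Fin n → ℂ), range f = V ∧
      ∀ a ∈ V, ∀ b ∈ V, ∀ c ∈ V, (fun j => a j * b j * starRingEnd ℂ (c j)) ∈ V := by
  obtain ⟨p₀, hp₀⟩ := h0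
  let e := chartAt (Fin k → ℂ) p₀
  have hx : e p₀ ∈ e.target := mem_chart_target _ p₀
  have hpe : e.symm (e p₀) = p₀ := e.left_inv (mem_chart_source _ p₀)
  let D := fderiv ℂ (f ∘ e.symm) (e p₀)
  have hinj : Function.Injective D := injective_fderiv_chart hf p₀
  obtain ⟨A₀, hA₀⟩ := LinearMap.exists_leftInverse_of_injective
    (D : (Fin k → ℂ) →ₗ[ℂ] (Fin n → ℂ)) (LinearMap.ker_eq_bot.2 hinj)
  let A : (Fin n → ℂ) →L[ℂ] (Fin k → ℂ) := LinearMap.toContinuousLinearMap A₀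
  have hAD : A.comp D = ContinuousLinearMap.id ℂ _ := by
    ext1 a
    exact DFunLike.congr_fun hA₀ a
  obtain ⟨hloc, htriple⟩ := local_structure e.open_target
    (analyticOnNhd_chart hf (chart_mem_atlas _ p₀))
    (holomorphicallyGeodesic_chart hf hg (chart_mem_atlas _ p₀)) hx
    (by rw [Function.comp_apply, hpe, hp₀]) hAD
  have hfD : ∀ p, f p = D (A (f p)) := by
    intro p
    have hev : ∀ᶠ p in 𝓝 p₀, (ContinuousLinearMap.id ℂ (Fin n → ℂ) - D.comp A) (f p) = 0 := by
      have hcont : ContinuousAt e p₀ := e.continuousAt (mem_chart_source _ p₀)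
      filter_upwards [e.open_source.mem_nhds (mem_chart_source _ p₀), hcont.eventually hloc]
        with q h1 h2
      rw [Function.comp_apply, e.left_inv h1] at h2
      simpa [sub_eq_zero] using h2
    have := clm_comp_eq_zero hf _ hev p
    simpa [sub_eq_zero] using this
  refine ⟨LinearMap.range (D : (Fin k → ℂ) →ₗ[ℂ] (Fin n → ℂ)),
    range_eq_of_complete hf hc ?_ (fun p => ⟨_, (hfD p).symm⟩) hp₀, ?_⟩
  · rw [LinearMap.finrank_range_of_inj hinj]
    simp
  · rintro _ ⟨a, rfl⟩ _ ⟨b, rfl⟩ _ ⟨c, rfl⟩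
    obtain ⟨d, hd⟩ := htriple a b c
    exact ⟨d, hd⟩

end Immersion

end Cigar

end

theorem theorem2 (n : ℕ) :
    ∃ Ψ : (Fin n → ℂ) → (Fin n → ℂ),
      (∀ (z : Fin n → ℂ) (j : Fin n),
        Ψ z j = ((Real.sqrt (Real.log (1 + ‖z j‖ ^ 2) / ‖z j‖ ^ 2) : ℝ) : ℂ) * z j) ∧
      Cigar.IsSymplectomorphism (Cigar.cigarForm n) (Cigar.standardForm n) Ψ ∧
      Ψ 0 = 0 ∧
      ∀ (k : ℕ) (S : Type*) [TopologicalSpace S] [T2Space S] [ConnectedSpace S]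
        [ChartedSpace (Fin k → ℂ) S] [IsManifold 𝓘(ℂ, Fin k → ℂ) ω S]
        (f : S → Fin n → ℂ),
        Cigar.IsHolomorphicImmersion k f →
        Cigar.IsTotallyGeodesic k (Cigar.cigarMetric n) f →
        Cigar.IsCompleteInduced k (Cigar.cigarMetric n) f →
        (0 : Fin n → ℂ) ∈ range f →
        ∃ W : Submodule ℂ (Fin n → ℂ), Ψ '' range f = (W : Set (Fin n → ℂ)) := by
  refine ⟨Cigar.radialMap n Cigar.logScale, fun z j => (Cigar.sqrt_log_div_mul (z j)).symm,
    Cigar.isSymplectomorphism_radialMap n, ?_, ?_⟩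
  · funext j
    simp [Cigar.radialMap]
  · intro k S _ _ _ _ _ f hf hg hc h0
    obtain ⟨V, hV, htriple⟩ := Cigar.exists_range_eq hf hg hc h0
    exact ⟨V, by rw [hV, Cigar.image_radialMap_eq htriple]⟩
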